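/- Let $(\mathcal K,[\cdot,\cdot])$ be a complex Krein space and let $N$ be a bounded normal operator on $\mathcal K$, i.e. $NN^+=N^+N$, where $N^+$ is the Krein space adjoint. Put $A=\frac{N+N^+}{2}$ and $B=\frac{N-N^+}{2i}$. Let $p_1,\dots,p_m\in\mathbb R[x,y]\setminus\{0\}$ be real definitizing polynomials for $N$, i.e. $[p_j(A,B)v,v]\ge 0$ for all $v\in\mathcal K$ and $j=1,\dots,m$. Let $\mathcal H_j$ be the Hilbert space completion of $\mathcal K/\ker p_j(A,B)$ with respect to $[p_j(A,B)\cdot,\cdot]$, let $\mathcal H$ be the Hilbert space completion of $\mathcal K/\ker\big(\sum_{k=1}^m p_k(A,B)\big)$ with respect to $\big[\sum_{k=1}^m p_k(A,B)\,\cdot,\cdot\big]$, and let $T_j:\mathcal H_j\to\mathcal K$ and $T:\mathcal H\to\mathcal K$ be the (bounded, injective) adjoints of the factor mappings $\mathcal K\to\mathcal H_j$ and $\mathcal K\to\mathcal H$. Thus $T_jT_j^+=p_j(A,B)$ and $TT^+=\sum_{k=1}^m p_k(A,B)$. Let $R_j:\mathcal H_j\to\mathcal H$ be the Hilbert space adjoint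 of the continuous extension of $T^+x\mapsto T_j^+x$ $(x\in\mathcal K)$ to $\mathcal H$; it satisfies $TR_j=T_j$. Let $\Theta(N)=T^{-1}NT$, the unique bounded operator on $\mathcal H$ with $T\,\Theta(N)=NT$. Denote by $\rho(\Theta(N))$ its resolvent set; if $\mathcal H=\{0\}$ this is $\mathbb C$. Then for every $j\in\{1,\dots,m\}$ \[ \Big\{z\in\mathbb C:\ |p_j(\operatorname{Re}z,\operatorname{Im}z)|>\|R_jR_j^*\|\cdot\Big|\sum_{k=1}^m p_k(\operatorname{Re}z,\operatorname{Im}z)\Big|\Big\}\subseteq\rho(\Theta(N)). \] In particular, the zeros $z\in\mathbb C$ of $\sum_{k=1}^m p_k(\operatorname{Re}z,\operatorname{Im}z)$ are contained in \[ \rho(\Theta(N))\cup\{z\in\mathbb C:\ p_j(\operatorname{Re}z,\operatorname{Im}z)=0\ \text{ for all } j=1,\dots,m\}. \] -/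

import Mathlib

/-- A Krein space. The inner product of the ambient Hilbert space `K` is the one that belongs to a
fundamental decomposition `K = K₊ [+] K₋` of the Krein space, i.e. `⟪x, y⟫ = [J x, y]`, and `J` is the
corresponding fundamental symmetry `P₊ - P₋`: a linear self-adjoint involution. The indefinite
product `[x, y] = ⟪J x, y⟫` is `kreinInner` below. -/
class KreinSpace (K : Type*) [NormedAddCommGroup K] [InnerProductSpace ℂ K] [CompleteSpace K] where
  /-- the fundamental symmetry -/
  J : K →L[ℂ] K
  adjoint_J : ContinuousLinearMap.adjoint J = J
  J_comp_J : J ∘L J = ContinuousLinearMap.id ℂ K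

noncomputable section

namespace KreinSpace

variable {K : Type*} [NormedAddCommGroup K] [InnerProductSpace ℂ K] [CompleteSpace K] [KreinSpace K]
variable {H : Type*} [NormedAddCommGroup H] [InnerProductSpace ℂ H] [CompleteSpace H]

open ContinuousLinearMap

theorem J_J (x : K) : J (J x) = x := congrArg (fun S : K →L[ℂ] K => S x) J_comp_J

theorem inner_J (x y : K) : inner ℂ (J x) y = inner ℂ x (J y) := by
  rw [← adjoint_inner_left, adjoint_J]

/-- The indefinite product `[x, y]`, linear in the first and conjugate linear in the second variable
(Mathlib's `inner` is conjugate linear in the first one). -/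
def kreinInner (x y : K) : ℂ := inner ℂ y (J x)

/-- The Krein space adjoint `C⁺` of a bounded operator on `K`: `[C x, y] = [x, C⁺ y]`. -/
def kreinAdjoint (C : K →L[ℂ] K) : K →L[ℂ] K := J ∘L adjoint C ∘L J

theorem kreinInner_kreinAdjoint (C : K →L[ℂ] K) (x y : K) :
    kreinInner (C x) y = kreinInner x (kreinAdjoint C y) := by
  simp [kreinInner, kreinAdjoint, inner_J, J_J, adjoint_inner_left]

/-- The adjoint `T⁺ : K → H` of a bounded `T : H → K` from a Hilbert space to a Krein space. -/
def adjointToHilbert (T : H →L[ℂ] K) : K →L[ℂ] H := adjoint T ∘L J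

theorem kreinInner_adjointToHilbert (T : H →L[ℂ] K) (h : H) (x : K) :
    kreinInner (T h) x = inner ℂ (adjointToHilbert T x) h := by
  simp [kreinInner, adjointToHilbert, inner_J, adjoint_inner_left]

/-- The adjoint `S⁺ : H → K` of a bounded `S : K → H` from a Krein space to a Hilbert space. -/
def adjointToKrein (S : K →L[ℂ] H) : H →L[ℂ] K := J ∘L adjoint S

theorem kreinInner_adjointToKrein (S : K →L[ℂ] H) (h : H) (x : K) :
    kreinInner (adjointToKrein S h) x = inner ℂ (S x) h := by
  simp [kreinInner, adjointToKrein, J_J, adjoint_inner_right]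

theorem adjointToHilbert_adjointToKrein (S : K →L[ℂ] H) :
    adjointToHilbert (adjointToKrein S) = S := by
  ext x
  refine ext_inner_right ℂ fun h => ?_
  rw [← kreinInner_adjointToHilbert, kreinInner_adjointToKrein]

/-! ### Normal operators and definitizing polynomials -/

/-- `N` is normal: it commutes with its Krein space adjoint. -/
def IsKreinNormal (N : K →L[ℂ] K) : Prop := Commute N (kreinAdjoint N)

/-- `A = (N + N⁺) / 2` -/
def rePart (N : K →L[ℂ] K) : K →L[ℂ] K := (1 / 2 : ℂ) • (N + kreinAdjoint N)

/-- `B = (N - N⁺) / (2i)` -/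
def imPart (N : K →L[ℂ] K) : K →L[ℂ] K := (1 / (2 * Complex.I) : ℂ) • (N - kreinAdjoint N)

/-- `p(A, B)` for a real polynomial `p` in two variables and commuting operators `A`, `B`: the sum of
`c • A ^ a * B ^ b` over the monomials `c x ^ a y ^ b` of `p`. -/
def polyOp (p : MvPolynomial (Fin 2) ℝ) (A B : K →L[ℂ] K) : K →L[ℂ] K :=
  ∑ d ∈ p.support, ((p.coeff d : ℝ) : ℂ) • (A ^ d 0 * B ^ d 1)

/-- `[Q v, v] ≥ 0` for all `v`, i.e. `[Q v, v]` is real and nonnegative. -/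
def KreinNonneg (Q : K →L[ℂ] K) : Prop :=
  ∀ v : K, 0 ≤ (kreinInner (Q v) v).re ∧ (kreinInner (Q v) v).im = 0

/-- `p` is a real definitizing polynomial for the normal operator `N`. -/
def IsDefinitizing (N : K →L[ℂ] K) (p : MvPolynomial (Fin 2) ℝ) : Prop :=
  p ≠ 0 ∧ KreinNonneg (polyOp p (rePart N) (imPart N))

/-- `p(Re z, Im z)` -/
def evalAt (p : MvPolynomial (Fin 2) ℝ) (z : ℂ) : ℝ := MvPolynomial.eval ![z.re, z.im] p

theorem KreinNonneg.sum {ι : Type*} {s : Finset ι} {Q : ι → K →L[ℂ] K}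
    (hQ : ∀ i ∈ s, KreinNonneg (Q i)) : KreinNonneg (∑ i ∈ s, Q i) := by
  intro v
  have h : kreinInner ((∑ i ∈ s, Q i) v) v = ∑ i ∈ s, kreinInner (Q i v) v := by
    simp [kreinInner]
  rw [h, Complex.re_sum, Complex.im_sum]
  exact ⟨Finset.sum_nonneg fun i hi => (hQ i hi v).1, Finset.sum_eq_zero fun i hi => (hQ i hi v).2⟩

theorem commute_polyOp {N : K →L[ℂ] K} (hN : IsKreinNormal N) (p : MvPolynomial (Fin 2) ℝ) :
    Commute N (polyOp p (rePart N) (imPart N)) := by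
  have hA : Commute N (rePart N) := ((Commute.refl N).add_right hN).smul_right _
  have hB : Commute N (imPart N) := ((Commute.refl N).sub_right hN).smul_right _
  exact Commute.sum_right _ _ _ fun d _ =>
    ((hA.pow_right _).mul_right (hB.pow_right _)).smul_right _

/-! ### The Hilbert space completion of `(K / ker Q, [Q ·, ·])` -/

/-- The vector space `K`, to be provided with the positive semidefinite product `[Q ·, ·]`. -/
def PreSpace (Q : K →L[ℂ] K) (_hQ : KreinNonneg Q) : Type _ := K

instance (Q : K →L[ℂ] K) (hQ : KreinNonneg Q) : AddCommGroup (PreSpace Q hQ) :=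
  inferInstanceAs (AddCommGroup K)

instance (Q : K →L[ℂ] K) (hQ : KreinNonneg Q) : Module ℂ (PreSpace Q hQ) :=
  inferInstanceAs (Module ℂ K)

theorem KreinNonneg.isPositive {Q : K →L[ℂ] K} (hQ : KreinNonneg Q) : (J ∘L Q).IsPositive := by
  rw [isPositive_iff_complex]
  intro x
  have h := hQ x
  have e : inner ℂ ((J ∘L Q) x) x = starRingEnd ℂ (kreinInner (Q x) x) := by
    simp [kreinInner]
  rw [e]
  refine ⟨?_, by simpa using h.1⟩
  apply Complex.ext <;> simp [h.2]

/-- The product `[Q ·, ·]`. In Mathlib's order of the arguments: `inner x y = [Q y, x]`. -/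
abbrev preCore (Q : K →L[ℂ] K) (hQ : KreinNonneg Q) : PreInnerProductSpace.Core ℂ (PreSpace Q hQ) where
  inner x y := kreinInner (K := K) (Q y) x
  conj_inner_symm x y := by
    have h := hQ.isPositive.isSymmetric x y
    exact (inner_conj_symm _ _).trans h
  re_inner_nonneg x := (hQ x).1
  add_left x y z := by
    simp only [kreinInner]
    exact inner_add_left (𝕜 := ℂ) (E := K) x y _
  smul_left x y r := by
    simp only [kreinInner]
    exact inner_smul_left (𝕜 := ℂ) (E := K) x _ r

instance (Q : K →L[ℂ] K) (hQ : KreinNonneg Q) : SeminormedAddCommGroup (PreSpace Q hQ) :=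
  @InnerProductSpace.Core.toSeminormedAddCommGroup ℂ _ _ _ _ (preCore Q hQ)

instance (Q : K →L[ℂ] K) (hQ : KreinNonneg Q) : InnerProductSpace ℂ (PreSpace Q hQ) :=
  InnerProductSpace.ofCore (preCore Q hQ)

theorem preSpace_inner (Q : K →L[ℂ] K) (hQ : KreinNonneg Q) (x y : PreSpace Q hQ) :
    inner ℂ x y = kreinInner (K := K) (Q y) x := rfl

/-- The Hilbert space completion of `K / ker Q` with respect to `[Q ·, ·]`. (The null vectors of the
positive semidefinite `[Q ·, ·]` form `ker Q`, and `UniformSpace.Completion` is the Hausdorff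
completion, which identifies vectors whose difference is a null vector.) -/
abbrev HilbertOf (Q : K →L[ℂ] K) (hQ : KreinNonneg Q) : Type _ :=
  UniformSpace.Completion (PreSpace Q hQ)

/-- The identity mapping of the vector space `K`. -/
def toPre (Q : K →L[ℂ] K) (hQ : KreinNonneg Q) : K →ₗ[ℂ] PreSpace Q hQ where
  toFun x := x
  map_add' _ _ := rfl
  map_smul' _ _ := rfl

theorem norm_toPre_le (Q : K →L[ℂ] K) (hQ : KreinNonneg Q) (x : K) :
    ‖toPre Q hQ x‖ ≤ √‖J ∘L Q‖ * ‖x‖ := by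
  have h1 : ‖toPre Q hQ x‖ ^ 2 = (kreinInner (K := K) (Q x) x).re :=
    norm_sq_eq_re_inner (𝕜 := ℂ) (toPre Q hQ x)
  have h2 : (kreinInner (K := K) (Q x) x).re ≤ ‖J ∘L Q‖ * ‖x‖ ^ 2 := by
    calc (kreinInner (K := K) (Q x) x).re ≤ ‖kreinInner (K := K) (Q x) x‖ := Complex.re_le_norm _
      _ ≤ ‖x‖ * ‖(J ∘L Q) x‖ := norm_inner_le_norm _ _
      _ ≤ ‖x‖ * (‖J ∘L Q‖ * ‖x‖) := by gcongr; exact le_opNorm _ _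
      _ = _ := by ring
  refine le_of_sq_le_sq ?_ (by positivity)
  rw [mul_pow, Real.sq_sqrt (norm_nonneg _), h1]
  exact h2

/-- The factor mapping `x ↦ x + ker Q` of `K` into the Hilbert space `HilbertOf Q`. -/
def factorMap (Q : K →L[ℂ] K) (hQ : KreinNonneg Q) : K →L[ℂ] HilbertOf Q hQ :=
  UniformSpace.Completion.toComplL ∘L
    LinearMap.mkContinuous (toPre Q hQ) (√‖J ∘L Q‖) (norm_toPre_le Q hQ)

theorem factorMap_apply (Q : K →L[ℂ] K) (hQ : KreinNonneg Q) (x : K) :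
    factorMap Q hQ x = (toPre Q hQ x : HilbertOf Q hQ) := rfl

theorem inner_factorMap (Q : K →L[ℂ] K) (hQ : KreinNonneg Q) (x y : K) :
    inner ℂ (factorMap Q hQ x) (factorMap Q hQ y) = kreinInner (Q y) x := by
  rw [factorMap_apply, factorMap_apply, UniformSpace.Completion.inner_coe, preSpace_inner]
  rfl

theorem denseRange_factorMap (Q : K →L[ℂ] K) (hQ : KreinNonneg Q) :
    DenseRange (factorMap Q hQ) :=
  UniformSpace.Completion.denseRange_coe (α := PreSpace Q hQ)

/-- The mapping `T : HilbertOf Q → K`: the adjoint of the factor mapping. -/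
def embedding (Q : K →L[ℂ] K) (hQ : KreinNonneg Q) : HilbertOf Q hQ →L[ℂ] K :=
  adjointToKrein (factorMap Q hQ)

theorem adjointToHilbert_embedding (Q : K →L[ℂ] K) (hQ : KreinNonneg Q) :
    adjointToHilbert (embedding Q hQ) = factorMap Q hQ :=
  adjointToHilbert_adjointToKrein _

theorem embedding_injective (Q : K →L[ℂ] K) (hQ : KreinNonneg Q) :
    Function.Injective (embedding Q hQ) := by
  rw [injective_iff_map_eq_zero]
  intro h h0
  refine (denseRange_factorMap Q hQ).eq_zero_of_inner_right ℂ ?_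
  intro x
  rw [← kreinInner_adjointToKrein]
  change kreinInner (embedding Q hQ h) x = 0
  simp [h0, kreinInner]

/-- `T T⁺ = Q` -/
theorem embedding_comp_adjoint (Q : K →L[ℂ] K) (hQ : KreinNonneg Q) :
    embedding Q hQ ∘L adjointToHilbert (embedding Q hQ) = Q := by
  rw [adjointToHilbert_embedding]
  ext y
  have h : ∀ x, kreinInner (embedding Q hQ (factorMap Q hQ y)) x = kreinInner (Q y) x := fun x => by
    rw [embedding, kreinInner_adjointToKrein, inner_factorMap]
  have h' : J (embedding Q hQ (factorMap Q hQ y)) = J (Q y) := ext_inner_left ℂ h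
  simpa [J_J] using congrArg (J (K := K)) h'

/-! ### The contractions `R_j` -/

/-- For operators `P`, `Q` with `[P x, x] ≤ [Q x, x]`, the adjoint `R : HilbertOf P → HilbertOf Q` of
the continuous extension of `T_Q⁺ x ↦ T_P⁺ x` to a mapping `HilbertOf Q → HilbertOf P`. -/
def contraction (P Q : K →L[ℂ] K) (hP : KreinNonneg P) (hQ : KreinNonneg Q) :
    HilbertOf P hP →L[ℂ] HilbertOf Q hQ :=
  adjoint (LinearMap.extendOfNorm
    (adjointToHilbert (embedding P hP)).toLinearMap (adjointToHilbert (embedding Q hQ)).toLinearMap)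

/-- `T_P = T_Q R`, so that `R` is not a default value. -/
theorem embedding_comp_contraction (P Q : K →L[ℂ] K) (hP : KreinNonneg P) (hQ : KreinNonneg Q)
    (hPQ : KreinNonneg (Q - P)) :
    embedding Q hQ ∘L contraction P Q hP hQ = embedding P hP := by
  have hb : ∃ c : ℝ, ∀ x, ‖(factorMap P hP).toLinearMap x‖ ≤ c * ‖(factorMap Q hQ).toLinearMap x‖ := by
    refine ⟨1, fun x => ?_⟩
    rw [one_mul]
    refine le_of_sq_le_sq ?_ (norm_nonneg _)
    have h1 := norm_sq_eq_re_inner (𝕜 := ℂ) (factorMap P hP x)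
    have h2 := norm_sq_eq_re_inner (𝕜 := ℂ) (factorMap Q hQ x)
    rw [inner_factorMap] at h1 h2
    have h3 := (hPQ x).1
    have h4 : kreinInner ((Q - P) x) x = kreinInner (Q x) x - kreinInner (P x) x := by
      simp [kreinInner]
    rw [h4, Complex.sub_re] at h3
    simp only [RCLike.re_to_complex] at h1 h2
    change ‖factorMap P hP x‖ ^ 2 ≤ ‖factorMap Q hQ x‖ ^ 2
    linarith
  have key : ∀ x, LinearMap.extendOfNorm (factorMap P hP).toLinearMap
      (factorMap Q hQ).toLinearMap (factorMap Q hQ x) = factorMap P hP x := fun x =>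
    LinearMap.extendOfNorm_eq (denseRange_factorMap Q hQ) hb x
  ext h
  refine (J_J _).symm.trans (Eq.trans (congrArg J ?_) (J_J _))
  refine ext_inner_left ℂ fun x => ?_
  change kreinInner (embedding Q hQ (contraction P Q hP hQ h)) x = kreinInner (embedding P hP h) x
  rw [embedding, embedding, kreinInner_adjointToKrein, kreinInner_adjointToKrein, contraction,
    adjoint_inner_right, adjointToHilbert_embedding, adjointToHilbert_embedding, key]

/-! ### The mapping `Θ` -/

/-- If `C` commutes with `T T⁺`, then `‖T⁺ C x‖ ≤ c ‖T⁺ x‖` for some constant `c`. -/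
theorem exists_bound (T : H →L[ℂ] K) (C : K →L[ℂ] K)
    (hC : Commute C (T ∘L adjointToHilbert T)) :
    ∃ c : ℝ, ∀ x, ‖adjointToHilbert T (C x)‖ ≤ c * ‖adjointToHilbert T x‖ := by
  set S := adjointToHilbert T with hS
  set P := T ∘L S with hP
  have gram : ∀ x y, inner ℂ (S x) (S y) = kreinInner (P y) x := fun x y =>
    (kreinInner_adjointToHilbert T (S y) x).symm
  have step : ∀ D : K →L[ℂ] K, Commute D P → ∀ x,
      ‖S (D x)‖ ^ 2 ≤ ‖S (kreinAdjoint D (D x))‖ * ‖S x‖ := by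
    intro D hD x
    have h1 : inner ℂ (S (D x)) (S (D x)) = inner ℂ (S (kreinAdjoint D (D x))) (S x) := by
      rw [gram, gram]
      have : P (D x) = D (P x) := (congrArg (fun U : K →L[ℂ] K => U x) hD.eq).symm
      rw [this, kreinInner_kreinAdjoint]
    have h2 : ‖S (D x)‖ ^ 2 = ‖inner ℂ (S (D x)) (S (D x))‖ := by
      rw [inner_self_eq_norm_sq_to_K]; simp
    rw [h2, h1]
    exact norm_inner_le_norm _ _
  have adjP : ∀ x y, kreinInner (P x) y = kreinInner x (P y) := by
    intro x y
    rw [← gram, ← inner_conj_symm, gram]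
    simp [kreinInner, inner_J]
  have nondeg : ∀ u v : K, (∀ y, kreinInner u y = kreinInner v y) → u = v := by
    intro u v h
    have h' : J u = J v := ext_inner_left ℂ h
    simpa [J_J] using congrArg (J (K := K)) h'
  have adjL : ∀ (D : K →L[ℂ] K) (x y : K),
      kreinInner (kreinAdjoint D x) y = kreinInner x (D y) := by
    intro D x y
    simp [kreinInner, kreinAdjoint, J_J, adjoint_inner_right]
  have hadj : Commute (kreinAdjoint C) P := by
    ext x
    refine nondeg _ _ fun y => ?_
    have : P (C y) = C (P y) := (congrArg (fun U : K →L[ℂ] K => U y) hC.eq).symm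
    change kreinInner (kreinAdjoint C (P x)) y = kreinInner (P (kreinAdjoint C x)) y
    rw [adjL, adjP, adjP, adjL, this]
  set D := kreinAdjoint C * C with hD
  have hDP : Commute D P := hadj.mul_left hC
  have selfD : kreinAdjoint D = D := by
    ext x
    refine nondeg _ _ fun y => ?_
    rw [adjL, hD]
    change kreinInner x (kreinAdjoint C (C y)) = kreinInner (kreinAdjoint C (C x)) y
    rw [adjL, kreinInner_kreinAdjoint]
  have selfDn : ∀ n : ℕ, kreinAdjoint (D ^ n) = D ^ n := by
    intro n
    have hmove : ∀ x y, kreinInner ((D ^ n) x) y = kreinInner x ((D ^ n) y) := by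
      induction n with
      | zero => intro x y; simp
      | succ n ih =>
        intro x y
        rw [pow_succ]
        change kreinInner ((D ^ n) (D x)) y = kreinInner x ((D ^ n * D) y)
        rw [ih, kreinInner_kreinAdjoint, selfD, ← pow_succ, pow_succ']
        rfl
    ext x
    refine nondeg _ _ fun y => ?_
    rw [adjL, hmove]
  have stepn : ∀ n x, ‖S ((D ^ 2 ^ n) x)‖ ^ 2 ≤ ‖S ((D ^ 2 ^ (n + 1)) x)‖ * ‖S x‖ := by
    intro n x
    have := step (D ^ 2 ^ n) (hDP.pow_left _) x
    rw [selfDn] at this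
    have e : (D ^ 2 ^ (n + 1)) x = (D ^ 2 ^ n) ((D ^ 2 ^ n) x) := by
      rw [pow_succ 2 n, mul_two, pow_add]; rfl
    rwa [e]
  have boundD : ∀ x, ‖S (D x)‖ ≤ ‖D‖ * ‖S x‖ := by
    intro x
    rcases (norm_nonneg (S x)).eq_or_lt with hb | hb
    · have := stepn 0 x
      rw [← hb, mul_zero] at this
      have h0 : ‖S (D x)‖ = 0 := by
        have : ‖S ((D ^ 2 ^ 0) x)‖ = 0 := by nlinarith [norm_nonneg (S ((D ^ 2 ^ 0) x))]
        simpa using this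
      rw [h0, ← hb, mul_zero]
    · by_contra hcon
      push Not at hcon
      set b := ‖S x‖ with hbdef
      set a := ‖S (D x)‖ with ha
      have pw : ∀ n : ℕ, (a / b) ^ 2 ^ n * b ≤ ‖S ((D ^ 2 ^ n) x)‖ := by
        intro n
        induction n with
        | zero => simp [ha, div_mul_cancel₀ _ hb.ne']
        | succ n ih =>
          have h1 := stepn n x
          have h2 : ((a / b) ^ 2 ^ n * b) ^ 2 ≤ ‖S ((D ^ 2 ^ n) x)‖ ^ 2 :=
            pow_le_pow_left₀ (by positivity) ih 2
          have h3 : ((a / b) ^ 2 ^ (n + 1) * b) * b ≤ ‖S ((D ^ 2 ^ (n + 1)) x)‖ * b := by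
            refine le_trans (le_of_eq ?_) (h2.trans h1)
            rw [pow_succ 2 n, pow_mul]; ring
          exact le_of_mul_le_mul_right h3 hb
      have up : ∀ n : ℕ, ‖S ((D ^ 2 ^ n) x)‖ ≤ ‖S‖ * ‖x‖ * ‖D‖ ^ 2 ^ n := by
        intro n
        calc ‖S ((D ^ 2 ^ n) x)‖ ≤ ‖S‖ * ‖(D ^ 2 ^ n) x‖ := le_opNorm _ _
          _ ≤ ‖S‖ * (‖D ^ 2 ^ n‖ * ‖x‖) := by gcongr; exact le_opNorm _ _
          _ ≤ ‖S‖ * (‖D‖ ^ 2 ^ n * ‖x‖) := by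
            gcongr; exact norm_pow_le' D (by positivity)
          _ = _ := by ring
      have hab : ‖D‖ < a / b := by rwa [lt_div_iff₀ hb]
      rcases (norm_nonneg D).eq_or_lt with hd | hd
      · have := (pw 0).trans (up 0)
        rw [← hd] at this
        have hpos : 0 < a / b := hd ▸ hab
        have : 0 < (a / b) ^ 2 ^ 0 * b := by positivity
        simp at *
        linarith
      · have hr : 1 < a / b / ‖D‖ := by rwa [lt_div_iff₀ hd, one_mul]
        obtain ⟨n, hn⟩ := pow_unbounded_of_one_lt (‖S‖ * ‖x‖ / b) hr
        have h2 : (a / b / ‖D‖) ^ n ≤ (a / b / ‖D‖) ^ 2 ^ n :=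
          pow_le_pow_right₀ hr.le Nat.lt_two_pow_self.le
        have h3 := (pw n).trans (up n)
        have h4 : (a / b / ‖D‖) ^ 2 ^ n ≤ ‖S‖ * ‖x‖ / b := by
          rw [div_pow, div_le_div_iff₀ (by positivity) hb]
          exact h3
        linarith
  refine ⟨√‖D‖, fun x => ?_⟩
  refine le_of_sq_le_sq ?_ (by positivity)
  rw [mul_pow, Real.sq_sqrt (norm_nonneg _)]
  calc ‖S (C x)‖ ^ 2 ≤ ‖S (D x)‖ * ‖S x‖ := step C hC x
    _ ≤ ‖D‖ * ‖S x‖ * ‖S x‖ := by gcongr; exact boundD x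
    _ = _ := by ring

theorem kreinAdjoint_kreinAdjoint (C : K →L[ℂ] K) : kreinAdjoint (kreinAdjoint C) = C := by
  ext x
  simp [kreinAdjoint, adjoint_comp, adjoint_J, J_J]

theorem exists_theta (T : H →L[ℂ] K) (hT : Function.Injective T) (C : K →L[ℂ] K)
    (hC : Commute C (T ∘L adjointToHilbert T)) :
    ∃ D : H →L[ℂ] H, T ∘L D = C ∘L T := by
  have hdense : DenseRange (adjointToHilbert T) := by
    have h1 : (LinearMap.range (adjointToHilbert T).toLinearMap)ᗮ = ⊥ := by
      rw [Submodule.eq_bot_iff]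
      intro h hh
      apply hT
      rw [map_zero]
      have h' : J (T h) = 0 := ext_inner_left ℂ fun x => by
        have h2 := Submodule.mem_orthogonal _ _ |>.1 hh (adjointToHilbert T x) ⟨x, rfl⟩
        rw [← kreinInner_adjointToHilbert] at h2
        simpa [kreinInner] using h2
      simpa [J_J] using congrArg (J (K := K)) h'
    have h2 := Submodule.topologicalClosure_eq_top_iff.2 h1
    rw [← Submodule.dense_iff_topologicalClosure_eq_top] at h2
    exact h2
  have hself : kreinAdjoint (T ∘L adjointToHilbert T) = T ∘L adjointToHilbert T := by
    ext x
    simp [kreinAdjoint, adjointToHilbert, adjoint_comp, adjoint_J, J_J]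
  have hmul : ∀ U V : K →L[ℂ] K, kreinAdjoint (U * V) = kreinAdjoint V * kreinAdjoint U := by
    intro U V
    ext x
    simp [kreinAdjoint, mul_def, adjoint_comp, J_J]
  have hadj : Commute (kreinAdjoint C) (T ∘L adjointToHilbert T) := by
    have h := congrArg kreinAdjoint hC.eq
    rw [hmul, hmul, hself] at h
    exact h.symm
  have hb := exists_bound T (kreinAdjoint C) hadj
  set G : H →L[ℂ] H := LinearMap.extendOfNorm
    ((adjointToHilbert T) ∘L (kreinAdjoint C)).toLinearMap (adjointToHilbert T).toLinearMap with hG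
  have hGS : ∀ x, G (adjointToHilbert T x) = adjointToHilbert T (kreinAdjoint C x) := fun x =>
    LinearMap.extendOfNorm_eq hdense hb x
  refine ⟨adjoint G, ?_⟩
  ext h
  refine (J_J _).symm.trans (Eq.trans (congrArg J ?_) (J_J _))
  refine ext_inner_left ℂ fun x => ?_
  change kreinInner (T (adjoint G h)) x = kreinInner (C (T h)) x
  rw [kreinInner_adjointToHilbert, adjoint_inner_right, hGS, kreinInner_kreinAdjoint,
    kreinInner_adjointToHilbert]

/-- `Θ(C) = T⁻¹ C T` for an injective `T : H → K` and `C` in the commutant of `T T⁺`: the (unique)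
bounded operator `Θ(C)` on `H` with `T Θ(C) = C T`. -/
def Theta (T : H →L[ℂ] K) (hT : Function.Injective T) (C : K →L[ℂ] K)
    (hC : Commute C (T ∘L adjointToHilbert T)) : H →L[ℂ] H :=
  Classical.choose (exists_theta T hT C hC)

theorem comp_Theta (T : H →L[ℂ] K) (hT : Function.Injective T) (C : K →L[ℂ] K)
    (hC : Commute C (T ∘L adjointToHilbert T)) : T ∘L Theta T hT C hC = C ∘L T :=
  Classical.choose_spec (exists_theta T hT C hC)

/-! ### The objects that belong to `N` and `p_1, …, p_m` -/

section Setting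

variable {m : ℕ} (N : K →L[ℂ] K) (p : Fin m → MvPolynomial (Fin 2) ℝ)

/-- `p_j(A, B)` -/
def opP (j : Fin m) : K →L[ℂ] K := polyOp (p j) (rePart N) (imPart N)

/-- `∑_k p_k(A, B)` -/
def opSum : K →L[ℂ] K := ∑ k, opP N p k

variable {N p}

theorem opP_nonneg (hp : ∀ j, IsDefinitizing N (p j)) (j : Fin m) : KreinNonneg (opP N p j) :=
  (hp j).2

theorem opSum_nonneg (hp : ∀ j, IsDefinitizing N (p j)) : KreinNonneg (opSum N p) :=
  KreinNonneg.sum fun j _ => (hp j).2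

theorem opSum_sub_opP_nonneg (hp : ∀ j, IsDefinitizing N (p j)) (j : Fin m) :
    KreinNonneg (opSum N p - opP N p j) := by
  have h : opSum N p - opP N p j = ∑ k ∈ Finset.univ.erase j, opP N p k := by
    rw [opSum, ← Finset.add_sum_erase _ _ (Finset.mem_univ j), add_sub_cancel_left]
  rw [h]
  exact KreinNonneg.sum fun k _ => opP_nonneg hp k

/-- The Hilbert space `H_j`, the completion of `(K / ker p_j(A, B), [p_j(A, B) ·, ·])`. -/
abbrev SpaceH_j (hp : ∀ j, IsDefinitizing N (p j)) (j : Fin m) : Type _ :=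
  HilbertOf (opP N p j) (opP_nonneg hp j)

/-- The Hilbert space `H`, the completion of `(K / ker ∑_k p_k(A, B), [∑_k p_k(A, B) ·, ·])`. -/
abbrev SpaceH (hp : ∀ j, IsDefinitizing N (p j)) : Type _ :=
  HilbertOf (opSum N p) (opSum_nonneg hp)

/-- `T : H → K` -/
def mapT (hp : ∀ j, IsDefinitizing N (p j)) : SpaceH hp →L[ℂ] K :=
  embedding (opSum N p) (opSum_nonneg hp)

/-- `T_j : H_j → K` -/
def mapT_j (hp : ∀ j, IsDefinitizing N (p j)) (j : Fin m) : SpaceH_j hp j →L[ℂ] K :=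
  embedding (opP N p j) (opP_nonneg hp j)

/-- `R_j : H_j → H` -/
def mapR_j (hp : ∀ j, IsDefinitizing N (p j)) (j : Fin m) : SpaceH_j hp j →L[ℂ] SpaceH hp :=
  contraction (opP N p j) (opSum N p) (opP_nonneg hp j) (opSum_nonneg hp)

theorem mapT_comp_mapR_j (hp : ∀ j, IsDefinitizing N (p j)) (j : Fin m) :
    mapT hp ∘L mapR_j hp j = mapT_j hp j :=
  embedding_comp_contraction _ _ _ _ (opSum_sub_opP_nonneg hp j)

theorem mapT_injective (hp : ∀ j, IsDefinitizing N (p j)) : Function.Injective (mapT hp) :=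
  embedding_injective _ _

theorem commute_mapT (hN : IsKreinNormal N) (hp : ∀ j, IsDefinitizing N (p j)) :
    Commute N (mapT hp ∘L adjointToHilbert (mapT hp)) := by
  rw [mapT, embedding_comp_adjoint]
  exact Commute.sum_right _ _ _ fun j _ => commute_polyOp hN (p j)

/-- `Θ(N)`, a bounded operator on `H` -/
def thetaN (hN : IsKreinNormal N) (hp : ∀ j, IsDefinitizing N (p j)) : SpaceH hp →L[ℂ] SpaceH hp :=
  Theta (mapT hp) (mapT_injective hp) N (commute_mapT hN hp)

end Setting

end KreinSpace

end

/-!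
`Θ = Θ(N)` is normal, because `T` intertwines not only `Θ` with `N` but also `Θ*` with `N⁺`. The
pairs `(C, D)` with `T D = C T` form an algebra, so `T` intertwines `p(Re Θ, Im Θ)` with `p(A, B)`
for every real polynomial `p`. Since `T` is injective, `D` is determined by `C`; as
`∑ₖ pₖ(A, B) = T T⁺` and `pⱼ(A, B) = Tⱼ Tⱼ⁺ = T Rⱼ Rⱼ* T⁺`, it follows that
`∑ₖ pₖ(Re Θ, Im Θ) = T⁺ T` and `pⱼ(Re Θ, Im Θ) = Rⱼ Rⱼ* T⁺ T`. The functional calculus of the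
normal operator `Θ` turns `pⱼ(Re Θ, Im Θ) = Rⱼ Rⱼ* ∑ₖ pₖ(Re Θ, Im Θ)` into
`|pⱼ| ≤ ‖Rⱼ Rⱼ*‖ |∑ₖ pₖ|` on the spectrum of `Θ`.
-/

section FunctionalCalculus

open scoped ComplexStarModule

theorem continuous_ofReal_evalAt (p : MvPolynomial (Fin 2) ℝ) :
    Continuous fun z : ℂ => (KreinSpace.evalAt p z : ℂ) := by
  simp only [KreinSpace.evalAt, MvPolynomial.eval_eq', Fin.prod_univ_two, Matrix.cons_val_zero,
    Matrix.cons_val_one]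
  fun_prop

section TopologicalAlgebra

variable {𝓐 : Type*} [TopologicalSpace 𝓐] [Ring 𝓐] [StarRing 𝓐] [Algebra ℂ 𝓐]
  [ContinuousFunctionalCalculus ℂ 𝓐 IsStarNormal]

theorem cfc_evalAt [IsTopologicalSemiring 𝓐] [StarModule ℂ 𝓐] (p : MvPolynomial (Fin 2) ℝ) (a : 𝓐)
    [IsStarNormal a] :
    cfc (fun z : ℂ => (KreinSpace.evalAt p z : ℂ)) a =
      ∑ d ∈ p.support, ((p.coeff d : ℝ) : ℂ) • ((ℜ a : 𝓐) ^ d 0 * (ℑ a : 𝓐) ^ d 1) := by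
  have h_monomials : (fun z : ℂ => (KreinSpace.evalAt p z : ℂ)) =
      ∑ d ∈ p.support, fun z : ℂ =>
        ((p.coeff d : ℝ) : ℂ) • ((z.re : ℂ) ^ d 0 * (z.im : ℂ) ^ d 1) := by
    ext z
    simp [KreinSpace.evalAt, MvPolynomial.eval_eq', Fin.prod_univ_two]
  rw [h_monomials, cfc_sum _ _ _ fun d _ => by fun_prop]
  refine Finset.sum_congr rfl fun d _ => ?_
  rw [cfc_smul .., cfc_mul .., cfc_pow .., cfc_pow .., cfc_re_id a, cfc_im_id a]

theorem star_cfc_mul_cfc {a : 𝓐} {f : ℂ → ℂ} (hf : ContinuousOn f (spectrum ℂ a)) :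
    star (cfc f a) * cfc f a = cfc (fun z => ((‖f z‖ ^ 2 : ℝ) : ℂ)) a := by
  rw [← cfc_star, ← cfc_mul ..]
  simp only [RCLike.star_def, Complex.conj_mul', Complex.ofReal_pow]

end TopologicalAlgebra

open scoped ComplexOrder in
theorem norm_le_mul_norm_of_cfc_eq_mul_cfc {𝓐 : Type*} [CStarAlgebra 𝓐] {a w : 𝓐}
    [IsStarNormal a] {f g : ℂ → ℂ} (hf : ContinuousOn f (spectrum ℂ a))
    (hg : ContinuousOn g (spectrum ℂ a)) (h : cfc f a = w * cfc g a) {z : ℂ}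
    (hz : z ∈ spectrum ℂ a) : ‖f z‖ ≤ ‖w‖ * ‖g z‖ := by
  let := CStarAlgebra.spectralOrder 𝓐
  have := CStarAlgebra.spectralOrderedRing 𝓐
  have h_le : cfc (fun z => ((‖f z‖ ^ 2 : ℝ) : ℂ)) a ≤
      cfc (fun z => ((‖w‖ ^ 2 : ℝ) : ℂ) • ((‖g z‖ ^ 2 : ℝ) : ℂ)) a :=
    calc cfc (fun z => ((‖f z‖ ^ 2 : ℝ) : ℂ)) a
      _ = star (cfc g a) * (star w * w) * cfc g a := by
        rw [← star_cfc_mul_cfc hf, h, star_mul]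
        simp only [mul_assoc]
      _ ≤ star (cfc g a) * algebraMap ℝ 𝓐 (‖w‖ ^ 2) * cfc g a :=
        star_left_conjugate_le_conjugate CStarAlgebra.star_mul_le_algebraMap_norm_sq _
      _ = ((‖w‖ ^ 2 : ℝ) : ℂ) • (star (cfc g a) * cfc g a) := by
        rw [Algebra.algebraMap_eq_smul_one, mul_smul_one, smul_mul_assoc, Complex.coe_smul]
      _ = cfc (fun z => ((‖w‖ ^ 2 : ℝ) : ℂ) • ((‖g z‖ ^ 2 : ℝ) : ℂ)) a := by
        rw [star_cfc_mul_cfc hg, cfc_smul ..]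
  have h_sq := (cfc_le_iff _ _ a (by fun_prop) (by fun_prop)).1 h_le z hz
  rw [smul_eq_mul, ← Complex.ofReal_mul, Complex.real_le_real, ← mul_pow] at h_sq
  exact le_of_sq_le_sq h_sq (by positivity)

end FunctionalCalculus

section Intertwining

variable {R V W : Type*} [CommRing R]
  [AddCommGroup V] [Module R V] [TopologicalSpace V] [IsTopologicalAddGroup V]
  [ContinuousConstSMul R V]
  [AddCommGroup W] [Module R W] [TopologicalSpace W] [IsTopologicalAddGroup W]
  [ContinuousConstSMul R W]

/-- The algebra of the pairs `(C, D)` of operators on `W` and `V` with `T D = C T`. For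
injective `T` it is the graph of `Θ : C ↦ T⁻¹ C T`. -/
def intertwiningSubalgebra (T : V →L[R] W) : Subalgebra R ((W →L[R] W) × (V →L[R] V)) where
  carrier := {CD | T ∘L CD.2 = CD.1 ∘L T}
  mul_mem' {X Y} hX hY := by
    change T ∘L (X.2 ∘L Y.2) = (X.1 ∘L Y.1) ∘L T
    rw [← ContinuousLinearMap.comp_assoc, hX, ContinuousLinearMap.comp_assoc, hY,
      ContinuousLinearMap.comp_assoc]
  add_mem' {X Y} hX hY := by
    change T ∘L (X.2 + Y.2) = (X.1 + Y.1) ∘L T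
    rw [ContinuousLinearMap.comp_add, ContinuousLinearMap.add_comp, hX, hY]
  algebraMap_mem' r := by
    ext v
    simp [Algebra.algebraMap_eq_smul_one]

namespace intertwiningSubalgebra

variable {T : V →L[R] W} {C : W →L[R] W} {D D' : V →L[R] V}

theorem mem_iff : (C, D) ∈ intertwiningSubalgebra T ↔ T ∘L D = C ∘L T := Iff.rfl

theorem snd_unique (hT : Function.Injective T) (hD : (C, D) ∈ intertwiningSubalgebra T)
    (hD' : (C, D') ∈ intertwiningSubalgebra T) : D = D' := by
  ext v
  exact hT (DFunLike.congr_fun ((mem_iff.1 hD).trans (mem_iff.1 hD').symm) v)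

theorem snd_eq_comp (hT : Function.Injective T) {S : W →L[R] V} (hC : C = T ∘L S)
    (hD : (C, D) ∈ intertwiningSubalgebra T) : D = S ∘L T :=
  snd_unique hT hD (mem_iff.2 (hC ▸ rfl))

end intertwiningSubalgebra

end Intertwining

namespace KreinSpace

open ContinuousLinearMap intertwiningSubalgebra

open scoped ComplexStarModule

theorem polyOp_mem {E F : Type*} [NormedAddCommGroup E] [InnerProductSpace ℂ E]
    [NormedAddCommGroup F] [InnerProductSpace ℂ F] {T : E →L[ℂ] F} {A B : F →L[ℂ] F}
    {A' B' : E →L[ℂ] E} (hA : (A, A') ∈ intertwiningSubalgebra T)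
    (hB : (B, B') ∈ intertwiningSubalgebra T) (p : MvPolynomial (Fin 2) ℝ) :
    (polyOp p A B, polyOp p A' B') ∈ intertwiningSubalgebra T := by
  rw [polyOp, polyOp, prod_mk_sum]
  exact sum_mem fun d _ =>
    Subalgebra.smul_mem _ (mul_mem (pow_mem hA (d 0)) (pow_mem hB (d 1))) _

variable {K : Type*} [NormedAddCommGroup K] [InnerProductSpace ℂ K]
  [CompleteSpace K] [KreinSpace K]
variable {H : Type*} [NormedAddCommGroup H] [InnerProductSpace ℂ H] [CompleteSpace H]

theorem adjointToHilbert_comp {G : Type*} [NormedAddCommGroup G] [InnerProductSpace ℂ G]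
    [CompleteSpace G] (T : H →L[ℂ] K) (R : G →L[ℂ] H) :
    adjointToHilbert (T ∘L R) = adjoint R ∘L adjointToHilbert T := by
  rw [adjointToHilbert, adjoint_comp, comp_assoc, adjointToHilbert]

variable {T : H →L[ℂ] K} {N : K →L[ℂ] K} {D : H →L[ℂ] H}

theorem comp_adjointToHilbert_of_mem (hT : Function.Injective T)
    (hN : Commute N (T ∘L adjointToHilbert T)) (hD : (N, D) ∈ intertwiningSubalgebra T) :
    D ∘L adjointToHilbert T = adjointToHilbert T ∘L N := by
  ext x
  apply hT
  calc T (D (adjointToHilbert T x))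
    _ = N (T (adjointToHilbert T x)) := DFunLike.congr_fun (mem_iff.1 hD) _
    _ = T (adjointToHilbert T (N x)) := DFunLike.congr_fun hN.eq x

theorem kreinAdjoint_adjoint_mem (hT : Function.Injective T)
    (hN : Commute N (T ∘L adjointToHilbert T)) (hD : (N, D) ∈ intertwiningSubalgebra T) :
    (kreinAdjoint N, adjoint D) ∈ intertwiningSubalgebra T := by
  have h_adj := congrArg adjointToKrein (comp_adjointToHilbert_of_mem hT hN hD)
  ext h
  simpa [adjointToKrein, adjointToHilbert, kreinAdjoint, adjoint_J, J_J] using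
    DFunLike.congr_fun h_adj h

theorem isStarNormal_of_mem (hT : Function.Injective T) (hN : IsKreinNormal N)
    (hD : (N, D) ∈ intertwiningSubalgebra T)
    (hD' : (kreinAdjoint N, adjoint D) ∈ intertwiningSubalgebra T) : IsStarNormal D := by
  have h_left : (kreinAdjoint N * N, adjoint D * D) ∈ intertwiningSubalgebra T := by
    simpa only [Prod.mk_mul_mk] using mul_mem hD' hD
  have h_right : (N * kreinAdjoint N, D * adjoint D) ∈ intertwiningSubalgebra T := by
    simpa only [Prod.mk_mul_mk] using mul_mem hD hD'
  rw [hN.eq] at h_right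
  refine ⟨?_⟩
  rw [commute_iff_eq, star_eq_adjoint]
  exact snd_unique hT h_left h_right

theorem rePart_realPart_mem (hD : (N, D) ∈ intertwiningSubalgebra T)
    (hD' : (kreinAdjoint N, adjoint D) ∈ intertwiningSubalgebra T) :
    (rePart N, (ℜ D : H →L[ℂ] H)) ∈ intertwiningSubalgebra T := by
  have h_re : (ℜ D : H →L[ℂ] H) = (1 / 2 : ℂ) • (D + adjoint D) := by
    rw [realPart_apply_coe, star_eq_adjoint, ← Complex.coe_smul]
    norm_num
  rw [h_re, rePart]
  simpa only [Prod.mk_add_mk, Prod.smul_mk] using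
    (intertwiningSubalgebra T).smul_mem (add_mem hD hD') (1 / 2)

theorem imPart_imaginaryPart_mem (hD : (N, D) ∈ intertwiningSubalgebra T)
    (hD' : (kreinAdjoint N, adjoint D) ∈ intertwiningSubalgebra T) :
    (imPart N, (ℑ D : H →L[ℂ] H)) ∈ intertwiningSubalgebra T := by
  have h_im : (ℑ D : H →L[ℂ] H) = (1 / (2 * Complex.I) : ℂ) • (D - adjoint D) := by
    rw [imaginaryPart_apply_coe, star_eq_adjoint, ← Complex.coe_smul, smul_smul]
    congr 1
    simp [mul_comm]
  rw [h_im, imPart]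
  simpa only [Prod.mk_sub_mk, Prod.smul_mk] using
    (intertwiningSubalgebra T).smul_mem (sub_mem hD hD') (1 / (2 * Complex.I))

theorem polyOp_cfc_evalAt_mem [IsStarNormal D] (hD : (N, D) ∈ intertwiningSubalgebra T)
    (hD' : (kreinAdjoint N, adjoint D) ∈ intertwiningSubalgebra T) (p : MvPolynomial (Fin 2) ℝ) :
    (polyOp p (rePart N) (imPart N), cfc (fun z : ℂ => (evalAt p z : ℂ)) D) ∈
      intertwiningSubalgebra T := by
  rw [cfc_evalAt]
  exact polyOp_mem (rePart_realPart_mem hD hD') (imPart_imaginaryPart_mem hD hD') p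

section Setting

variable {m : ℕ} {p : Fin m → MvPolynomial (Fin 2) ℝ}

theorem opSum_eq_mapT_comp (hp : ∀ j, IsDefinitizing N (p j)) :
    opSum N p = mapT hp ∘L adjointToHilbert (mapT hp) :=
  (embedding_comp_adjoint (opSum N p) (opSum_nonneg hp)).symm

theorem opP_eq_mapT_comp (hp : ∀ j, IsDefinitizing N (p j)) (j : Fin m) :
    opP N p j =
      mapT hp ∘L (mapR_j hp j ∘L adjoint (mapR_j hp j)) ∘L adjointToHilbert (mapT hp) :=
  calc opP N p j
    _ = mapT_j hp j ∘L adjointToHilbert (mapT_j hp j) :=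
      (embedding_comp_adjoint (opP N p j) (opP_nonneg hp j)).symm
    _ = _ := by rw [← mapT_comp_mapR_j, adjointToHilbert_comp, comp_assoc, comp_assoc]

variable (hN : IsKreinNormal N) (hp : ∀ j, IsDefinitizing N (p j))

theorem thetaN_mem : (N, thetaN hN hp) ∈ intertwiningSubalgebra (mapT hp) :=
  comp_Theta (mapT hp) (mapT_injective hp) N (commute_mapT hN hp)

theorem adjoint_thetaN_mem :
    (kreinAdjoint N, adjoint (thetaN hN hp)) ∈ intertwiningSubalgebra (mapT hp) :=
  kreinAdjoint_adjoint_mem (mapT_injective hp) (commute_mapT hN hp) (thetaN_mem hN hp)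

instance isStarNormal_thetaN : IsStarNormal (thetaN hN hp) :=
  isStarNormal_of_mem (mapT_injective hp) hN (thetaN_mem hN hp) (adjoint_thetaN_mem hN hp)

theorem cfc_sum_evalAt_thetaN :
    cfc (fun z : ℂ => ∑ k, (evalAt (p k) z : ℂ)) (thetaN hN hp) =
      adjointToHilbert (mapT hp) ∘L mapT hp := by
  have h_cfc : cfc (fun z : ℂ => ∑ k, (evalAt (p k) z : ℂ)) (thetaN hN hp) =
      ∑ k, cfc (fun z : ℂ => (evalAt (p k) z : ℂ)) (thetaN hN hp) := by
    rw [← cfc_sum_univ _ _ fun k => (continuous_ofReal_evalAt (p k)).continuousOn, Finset.sum_fn]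
  have h_mem : (∑ k, opP N p k, ∑ k, cfc (fun z : ℂ => (evalAt (p k) z : ℂ)) (thetaN hN hp)) ∈
      intertwiningSubalgebra (mapT hp) := by
    rw [prod_mk_sum]
    exact sum_mem fun k _ =>
      polyOp_cfc_evalAt_mem (thetaN_mem hN hp) (adjoint_thetaN_mem hN hp) (p k)
  rw [h_cfc]
  exact snd_eq_comp (mapT_injective hp) (opSum_eq_mapT_comp hp) h_mem

theorem cfc_evalAt_thetaN (j : Fin m) :
    cfc (fun z : ℂ => (evalAt (p j) z : ℂ)) (thetaN hN hp) =
      ((mapR_j hp j ∘L adjoint (mapR_j hp j)) ∘L adjointToHilbert (mapT hp)) ∘L mapT hp :=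
  snd_eq_comp (mapT_injective hp) (opP_eq_mapT_comp hp j)
    (polyOp_cfc_evalAt_mem (thetaN_mem hN hp) (adjoint_thetaN_mem hN hp) (p j))

variable {hN hp} in
theorem abs_evalAt_le_of_mem_spectrum_thetaN {z : ℂ} (hz : z ∈ spectrum ℂ (thetaN hN hp))
    (j : Fin m) :
    |evalAt (p j) z| ≤ ‖mapR_j hp j ∘L adjoint (mapR_j hp j)‖ * |∑ k, evalAt (p k) z| := by
  have h_factor : cfc (fun z : ℂ => (evalAt (p j) z : ℂ)) (thetaN hN hp) =
      (mapR_j hp j ∘L adjoint (mapR_j hp j)) *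
        cfc (fun z : ℂ => ∑ k, (evalAt (p k) z : ℂ)) (thetaN hN hp) := by
    rw [cfc_evalAt_thetaN, cfc_sum_evalAt_thetaN, mul_def, comp_assoc]
  have h_sum : Continuous fun z : ℂ => ∑ k, (evalAt (p k) z : ℂ) :=
    continuous_finsetSum _ fun k _ => continuous_ofReal_evalAt (p k)
  have h_norm := norm_le_mul_norm_of_cfc_eq_mul_cfc
    (continuous_ofReal_evalAt (p j)).continuousOn h_sum.continuousOn h_factor hz
  rwa [← Complex.ofReal_sum, Complex.norm_real, Complex.norm_real] at h_norm

end Setting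

end KreinSpace

theorem mainTheorem11 {K : Type*} [NormedAddCommGroup K] [InnerProductSpace ℂ K] [CompleteSpace K]
    [KreinSpace K] (N : K →L[ℂ] K) (hN : KreinSpace.IsKreinNormal N)
    {m : ℕ} (p : Fin m → MvPolynomial (Fin 2) ℝ)
    (hp : ∀ j, KreinSpace.IsDefinitizing N (p j)) :
    (∀ j : Fin m,
      {z : ℂ | |KreinSpace.evalAt (p j) z| >
          ‖KreinSpace.mapR_j hp j ∘L ContinuousLinearMap.adjoint (KreinSpace.mapR_j hp j)‖ *
            |∑ k, KreinSpace.evalAt (p k) z|} ⊆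
        resolventSet ℂ (KreinSpace.thetaN hN hp)) ∧
    {z : ℂ | ∑ k, KreinSpace.evalAt (p k) z = 0} ⊆
      resolventSet ℂ (KreinSpace.thetaN hN hp) ∪
        {z : ℂ | ∀ j : Fin m, KreinSpace.evalAt (p j) z = 0} := by
  have h_resolvent (j : Fin m) (z : ℂ) (hz : |KreinSpace.evalAt (p j) z| >
      ‖KreinSpace.mapR_j hp j ∘L ContinuousLinearMap.adjoint (KreinSpace.mapR_j hp j)‖ *
        |∑ k, KreinSpace.evalAt (p k) z|) : z ∈ resolventSet ℂ (KreinSpace.thetaN hN hp) := by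
    by_contra h_spectrum
    exact (KreinSpace.abs_evalAt_le_of_mem_spectrum_thetaN h_spectrum j).not_gt hz
  refine ⟨h_resolvent, fun z (hz : ∑ k, KreinSpace.evalAt (p k) z = 0) => ?_⟩
  refine or_iff_not_imp_left.2 fun h_spectrum j => ?_
  simpa [hz] using KreinSpace.abs_evalAt_le_of_mem_spectrum_thetaN h_spectrum j
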